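/- **Theorem (Denotational model for xPTCL).** *Types and syntax.* Let $\mathsf{Ty}$ be the set of simple types $\tau ::= \mathsf{unit} \mid \tau\to\tau$, and let $\mathbf{Set}^{\mathsf{Ty}}$ be the category of $\mathsf{Ty}$-sorted sets. Let $\Sigma^{\mathsf p}$ be the polynomial endofunctor of $\mathbf{Set}^{\mathsf{Ty}}$ given by the signature with operations, for all types $\tau,\tau_i$, $$\mathsf e:\mathsf{unit},\quad \mathsf{app}:(\tau_1\to\tau_2)\times\tau_1\to\tau_2,\quad I:\tau\to\tau,\quad K:\tau_1\to\tau_2\to\tau_1,\quad K':\tau_1\Rightarrow(\tau_2\to\tau_1),$$ $$S:(\tau_1\to\tau_2\to\tau_3)\to(\tau_1\to\tau_2)\to\tau_1\to\tau_3,\quad S':(\tau_1\to\tau_2\to\tau_3)\Rightarrow((\tau_1\to\tau_2)\to\tau_1\to\tau_3),$$ $$S'':(\tau_1\to\tau_2\to\tau_3)\times(\tau_1\to\tau_2)\Rightarrow(\tau_1\to\tau_3),\quad \oplus:\tau\times\tau\Rightarrow\tau$$ ($\mathsf e,I,K,S$ are constants, $\Rightarrow$ separates argument sorts from the result sort, and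 $p\,q$ abbreviates $\mathsf{app}(p,q)$). Let $\Sigma^{\mathsf p\star}$ be the free (term) monad and $\mu\Sigma^{\mathsf p}$ the initial algebra of closed terms (programs). *Behaviour.* Let $\mathcal D_\omega X$ be the set of finitely supported probability distributions on $X$, and let $B^{\mathsf p}:(\mathbf{Set}^{\mathsf{Ty}})^{\mathrm{op}}\times\mathbf{Set}^{\mathsf{Ty}}\to\mathbf{Set}^{\mathsf{Ty}}$ be the bifunctor $$B^{\mathsf p}_{\mathsf{unit}}(X,Y)=\mathcal D_\omega(Y_{\mathsf{unit}})+1,\qquad B^{\mathsf p}_{\tau_1\to\tau_2}(X,Y)=\mathcal D_\omega(Y_{\tau_1\to\tau_2})+Y_{\tau_2}^{X_{\tau_1}}.$$ A higher-order coalgebra is a map $c:C\to B^{\mathsf p}(C,C)$; a morphism $h:(C,c)\to(D,d)$ is a map $h:C\to D$ with $B^{\mathsf p}(\mathrm{id},h)\cdot c=B^{\mathsf p}(h,\mathrm{id})\cdot d\cdot h$. A higher-order coalgebra $z:Z\to B^{\mathsf p}(Z,Z)$ is *locally final* if it is a final coalgebra for the endofunctor $B^{\mathsf p}(Z,-)$.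 *Operational semantics.* Let $\rho^{\mathsf p}_{X,Y}:\Sigma^{\mathsf p}(X\times B^{\mathsf p}(X,Y))\to B^{\mathsf p}(X,\Sigma^{\mathsf p\star}(X+Y))$ (dinatural in $X$, natural in $Y$) be the higher-order GSOS law given, with coproduct injections and variables left implicit, by $$\mathsf e\mapsto *,\quad S\mapsto\lambda t.\,S'(t),\quad S'(p,\_)\mapsto\lambda t.\,S''(p,t),\quad S''((p,\_),(q,\_))\mapsto\lambda t.\,(p\,t)(q\,t),$$ $$K\mapsto\lambda t.\,K'(t),\quad K'(p,\_)\mapsto\lambda t.\,p,\quad I\mapsto\lambda t.\,t,\quad (p,\_)\oplus(q,\_)\mapsto \tfrac12\cdot p+\tfrac12\cdot q,$$ $$\mathsf{app}((p,\textstyle\sum_i r_i\cdot p_i),(q,\_))\mapsto\textstyle\sum_i r_i\cdot(p_i\,q),\qquad \mathsf{app}((p,f),(q,\_))\mapsto 1\cdot f(q).$$ A *$\rho^{\mathsf p}$-bialgebra* is an object $X$ with maps $\Sigma^{\mathsf p}X\xrightarrow{a}X\xrightarrow{c}B^{\mathsf p}(X,X)$ such that $c\cdot a=B^{\mathsf p}(\mathrm{id},\hat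 a\cdot\Sigma^{\mathsf p\star}\nabla)\cdot\rho^{\mathsf p}_{X,X}\cdot\Sigma^{\mathsf p}\langle\mathrm{id},c\rangle$, where $\hat a:\Sigma^{\mathsf p\star}X\to X$ evaluates terms in $(X,a)$ and $\nabla:X+X\to X$ is the codiagonal. The *operational model* $\gamma^{\mathsf p}:\mu\Sigma^{\mathsf p}\to B^{\mathsf p}(\mu\Sigma^{\mathsf p},\mu\Sigma^{\mathsf p})$ is the unique map making $\mu\Sigma^{\mathsf p}$, with its initial algebra structure, a $\rho^{\mathsf p}$-bialgebra. A *denotational model* is a $\rho^{\mathsf p}$-bialgebra whose underlying higher-order coalgebra is locally final. *Bisimilarity.* A $\mathsf{Ty}$-indexed equivalence relation $R$ on $\mu\Sigma^{\mathsf p}$ is a *strong probabilistic applicative bisimulation* if for all $p\mathrel{R_\tau}q$ one of the following holds: (1) $\gamma^{\mathsf p}(p),\gamma^{\mathsf p}(q)\in\mathcal D_\omega(\mu\Sigma^{\mathsf p}_\tau)$ and $\sum_{t\in E}\gamma^{\mathsf p}(p)(t)=\sum_{t\in E}\gamma^{\mathsf p}(q)(t)$ for every equivalence class $E$ of $R_\tau$;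 (2) $\tau=\mathsf{unit}$ and $\gamma^{\mathsf p}(p)=\gamma^{\mathsf p}(q)=*$; (3) $\tau=\tau_1\to\tau_2$, both $\gamma^{\mathsf p}(p)$ and $\gamma^{\mathsf p}(q)$ are functions $\mu\Sigma^{\mathsf p}_{\tau_1}\to\mu\Sigma^{\mathsf p}_{\tau_2}$, and $\gamma^{\mathsf p}(p)(t)\mathrel{R_{\tau_2}}\gamma^{\mathsf p}(q)(t)$ for every $t\in\mu\Sigma^{\mathsf p}_{\tau_1}$. Let *strong probabilistic applicative bisimilarity* $\sim^{\mathsf p}$ be the join of all such relations in the lattice of $\mathsf{Ty}$-indexed equivalence relations. Then: 1. $B^{\mathsf p}$ has a locally final coalgebra, and any two locally final coalgebras for $B^{\mathsf p}$ are isomorphic as higher-order coalgebras. 2. The relation $\sim^{\mathsf p}$ is itself a strong probabilistic applicative bisimulation, hence the greatest one, and it is behavioural equivalence on $(\mu\Sigma^{\mathsf p},\gamma^{\mathsf p})$: $p\sim^{\mathsf p}_\tau q$ if and only if $\mathsf{beh}_\tau(p)=\mathsf{beh}_\tau(q)$, where $\mathsf{beh}$ is the unique $B^{\mathsf p}(\mu\Sigma^{\mathsf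 p},-)$-coalgebra morphism from $(\mu\Sigma^{\mathsf p},\gamma^{\mathsf p})$ to a final coalgebra for $B^{\mathsf p}(\mu\Sigma^{\mathsf p},-)$. 3. Every locally final coalgebra $(Z,z)$ extends, by some algebra structure $a:\Sigma^{\mathsf p}Z\to Z$, to a denotational model $(Z,a,z)$ that is adequate: the final coalgebra $\nu B^{\mathsf p}(\mu\Sigma^{\mathsf p},-)$ exists, the map $\mathsf{beh}:\mu\Sigma^{\mathsf p}\to\nu B^{\mathsf p}(\mu\Sigma^{\mathsf p},-)$ factorizes through the unique $\Sigma^{\mathsf p}$-algebra morphism $[\![-]\!]:\mu\Sigma^{\mathsf p}\to(Z,a)$, and consequently, for all $\tau$ and $p,q\in\mu\Sigma^{\mathsf p}_\tau$, $[\![p]\!]_\tau=[\![q]\!]_\tau$ implies $p\sim^{\mathsf p}_\tau q$. -/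

import Mathlib

open CategoryTheory CategoryTheory.Limits Opposite Convexity

/-! ### Higher-order coalgebras for a mixed-variance bifunctor -/

section HigherOrder

universe v u

/-- A higher-order coalgebra `V ⟶ B(V, V)` for a bifunctor `B : Cᵒᵖ × C → C` (in curried form). -/
structure HOCoalgebra {C : Type u} [Category.{v} C] (B : Cᵒᵖ ⥤ C ⥤ C) where
  V : C
  str : V ⟶ (B.obj (op V)).obj V

namespace HOCoalgebra

variable {C : Type u} [Category.{v} C] {B : Cᵒᵖ ⥤ C ⥤ C}

/-- Morphisms `h : (C, c) ⟶ (D, d)` of higher-order coalgebras: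
`B(id, h) ∘ c = B(h, id) ∘ d ∘ h` as morphisms `C ⟶ B(C, D)`. -/
@[ext]
structure Hom (P Q : HOCoalgebra B) where
  f : P.V ⟶ Q.V
  h : P.str ≫ (B.obj (op P.V)).map f = f ≫ Q.str ≫ (B.map f.op).app Q.V

instance : Category (HOCoalgebra B) where
  Hom := Hom
  id P := ⟨𝟙 P.V, by simp⟩
  comp {P Q R} f g := ⟨f.f ≫ g.f, by
    have hf := f.h
    have hg := g.h
    simp only [Functor.map_comp, op_comp, NatTrans.comp_app, Category.assoc]
    rw [← Category.assoc, hf]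
    simp only [Category.assoc]
    rw [← (B.map f.f.op).naturality, reassoc_of% hg]⟩

/-- The underlying coalgebra for the endofunctor `B(V, -)`. -/
def toCoalgebra (P : HOCoalgebra B) : Endofunctor.Coalgebra (B.obj (op P.V)) :=
  ⟨P.V, P.str⟩

/-- A higher-order coalgebra `(Z, z)` is locally final if it is a final coalgebra for `B(Z, -)`. -/
def IsLocallyFinal (P : HOCoalgebra B) : Prop :=
  Nonempty (IsTerminal P.toCoalgebra)

end HOCoalgebra

end HigherOrder

namespace XPTCL

/-! ### Types and type-sorted sets -/

/-- Simple types: `τ ::= unit | τ → τ`. -/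
inductive Ty : Type
  | unit : Ty
  | arr : Ty → Ty → Ty

/-- `Ty`-sorted sets. -/
structure TySet : Type 1 where
  El : Ty → Type

instance : CoeFun TySet fun _ => Ty → Type := ⟨TySet.El⟩

/-- The category `Set^Ty` of `Ty`-sorted sets and sortwise maps. -/
instance : Category TySet where
  Hom X Y := ∀ τ : Ty, X τ → Y τ
  id _ := fun _ x => x
  comp f g := fun τ x => g τ (f τ x)

@[simp] theorem id_apply (X : TySet) (τ : Ty) (x : X τ) : (𝟙 X : X ⟶ X) τ x = x := rfl

@[simp] theorem comp_apply {X Y Z : TySet} (f : X ⟶ Y) (g : Y ⟶ Z) (τ : Ty) (x : X τ) :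
    (f ≫ g) τ x = g τ (f τ x) := rfl

theorem TySet.hom_ext {X Y : TySet} {f g : X ⟶ Y} (h : ∀ τ x, f τ x = g τ x) : f = g :=
  funext fun τ => funext fun x => h τ x

/-- Binary products of sorted sets. -/
abbrev prodSet (X Y : TySet) : TySet := ⟨fun τ => X τ × Y τ⟩

def prodMap {X X' Y Y' : TySet} (f : X ⟶ X') (g : Y ⟶ Y') : prodSet X Y ⟶ prodSet X' Y' :=
  fun τ x => (f τ x.1, g τ x.2)

/-- The pairing `⟨f, g⟩`. -/
def pairing {W X Y : TySet} (f : W ⟶ X) (g : W ⟶ Y) : W ⟶ prodSet X Y :=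
  fun τ w => (f τ w, g τ w)

/-- Binary coproducts of sorted sets. -/
abbrev coprodSet (X Y : TySet) : TySet := ⟨fun τ => X τ ⊕ Y τ⟩

def coprodMap {X X' Y Y' : TySet} (f : X ⟶ X') (g : Y ⟶ Y') : coprodSet X Y ⟶ coprodSet X' Y' :=
  fun τ => Sum.map (f τ) (g τ)

/-- The codiagonal `∇ : X + X ⟶ X`. -/
def codiag (X : TySet) : coprodSet X X ⟶ X :=
  fun _ => Sum.elim id id

/-! ### Syntax -/

/-- The polynomial functor of the signature of xPTCL, on objects. Here `s1`, `s2`, `k1` are the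
auxiliary operators `S'`, `S''`, `K'`, and `choice` is the fair probabilistic choice `⊕`. -/
inductive Sig (X : TySet) : Ty → Type
  | e : Sig X Ty.unit
  | app {a b : Ty} : X (Ty.arr a b) → X a → Sig X b
  | s (a b c : Ty) :
      Sig X (Ty.arr (Ty.arr a (Ty.arr b c)) (Ty.arr (Ty.arr a b) (Ty.arr a c)))
  | s1 {a b c : Ty} : X (Ty.arr a (Ty.arr b c)) → Sig X (Ty.arr (Ty.arr a b) (Ty.arr a c))
  | s2 {a b c : Ty} : X (Ty.arr a (Ty.arr b c)) → X (Ty.arr a b) → Sig X (Ty.arr a c)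
  | k (a b : Ty) : Sig X (Ty.arr a (Ty.arr b a))
  | k1 {a : Ty} (b : Ty) : X a → Sig X (Ty.arr b a)
  | i (a : Ty) : Sig X (Ty.arr a a)
  | choice {a : Ty} : X a → X a → Sig X a

def Sig.map {X Y : TySet} (f : X ⟶ Y) : ∀ τ, Sig X τ → Sig Y τ
  | _, .e => .e
  | _, .app p q => .app (f _ p) (f _ q)
  | _, .s a b c => .s a b c
  | _, .s1 p => .s1 (f _ p)
  | _, .s2 p q => .s2 (f _ p) (f _ q)
  | _, .k a b => .k a b
  | _, .k1 b p => .k1 b (f _ p)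
  | _, .i a => .i a
  | _, .choice p q => .choice (f _ p) (f _ q)

/-- The syntax functor `Σ` of xPTCL. -/
def SigF : TySet ⥤ TySet where
  obj X := ⟨Sig X⟩
  map f := Sig.map f
  map_id X := by
    refine funext fun τ => funext fun x => ?_
    cases x <;> rfl
  map_comp {X _ _} f g := by
    refine funext fun τ => funext fun x => ?_
    cases x <;> rfl

/-- `Σ`-terms with variables from the sorted set `V`. -/
inductive Tm (V : TySet) : Ty → Type
  | var {a : Ty} : V a → Tm V a
  | e : Tm V Ty.unit
  | app {a b : Ty} : Tm V (Ty.arr a b) → Tm V a → Tm V b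
  | s (a b c : Ty) :
      Tm V (Ty.arr (Ty.arr a (Ty.arr b c)) (Ty.arr (Ty.arr a b) (Ty.arr a c)))
  | s1 {a b c : Ty} : Tm V (Ty.arr a (Ty.arr b c)) → Tm V (Ty.arr (Ty.arr a b) (Ty.arr a c))
  | s2 {a b c : Ty} : Tm V (Ty.arr a (Ty.arr b c)) → Tm V (Ty.arr a b) → Tm V (Ty.arr a c)
  | k (a b : Ty) : Tm V (Ty.arr a (Ty.arr b a))
  | k1 {a : Ty} (b : Ty) : Tm V a → Tm V (Ty.arr b a)
  | i (a : Ty) : Tm V (Ty.arr a a)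
  | choice {a : Ty} : Tm V a → Tm V a → Tm V a

/-- The free `Σ`-algebra `Σ⋆ V`, as a sorted set. -/
abbrev Free (V : TySet) : TySet := ⟨Tm V⟩

/-- The `Σ`-algebra structure of `Σ⋆ V`. -/
def Free.iota (V : TySet) : SigF.obj (Free V) ⟶ Free V
  | _, .e => Tm.e
  | _, .app p q => Tm.app p q
  | _, .s a b c => Tm.s a b c
  | _, .s1 p => Tm.s1 p
  | _, .s2 p q => Tm.s2 p q
  | _, .k a b => Tm.k a b
  | _, .k1 b p => Tm.k1 b p
  | _, .i a => Tm.i a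
  | _, .choice p q => Tm.choice p q

/-- The unit `V ⟶ Σ⋆ V`. -/
def Free.eta (V : TySet) : V ⟶ Free V := fun _ x => Tm.var x

/-- The free extension of `v : V ⟶ A` to `Σ⋆ V ⟶ A` for a `Σ`-algebra `(A, a)`. -/
def Free.eval {V A : TySet} (v : V ⟶ A) (a : SigF.obj A ⟶ A) : Free V ⟶ A
  | _, .var x => v _ x
  | _, .e => a _ Sig.e
  | _, .app p q => a _ (Sig.app (Free.eval v a _ p) (Free.eval v a _ q))
  | _, .s x y z => a _ (Sig.s x y z)
  | _, .s1 p => a _ (Sig.s1 (Free.eval v a _ p))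
  | _, .s2 p q => a _ (Sig.s2 (Free.eval v a _ p) (Free.eval v a _ q))
  | _, .k x y => a _ (Sig.k x y)
  | _, .k1 y p => a _ (Sig.k1 y (Free.eval v a _ p))
  | _, .i x => a _ (Sig.i x)
  | _, .choice p q => a _ (Sig.choice (Free.eval v a _ p) (Free.eval v a _ q))

theorem Free.iota_eval {V A : TySet} (v : V ⟶ A) (a : SigF.obj A ⟶ A) :
    Free.iota V ≫ Free.eval v a = SigF.map (Free.eval v a) ≫ a := by
  refine TySet.hom_ext fun τ x => ?_
  cases x <;> rfl

theorem Free.eval_unique {V A : TySet} (v : V ⟶ A) (a : SigF.obj A ⟶ A) (h : Free V ⟶ A)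
    (hv : Free.eta V ≫ h = v) (ha : Free.iota V ≫ h = SigF.map h ≫ a) : h = Free.eval v a := by
  have ha' : ∀ τ (x : Sig (Free V) τ), h τ (Free.iota V τ x) = a τ (Sig.map h τ x) :=
    fun τ x => congrFun (congrFun ha τ) x
  refine TySet.hom_ext fun τ t => ?_
  change Tm V τ at t
  induction t with
  | var x => exact congrFun (congrFun hv _) x
  | e => exact ha' _ Sig.e
  | app p q ihp ihq =>
    refine (ha' _ (Sig.app p q)).trans ?_
    change a _ (Sig.app (h _ p) (h _ q)) = _
    rw [ihp, ihq]; rfl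
  | s x y z => exact ha' _ (Sig.s x y z)
  | s1 p ihp =>
    refine (ha' _ (Sig.s1 p)).trans ?_
    change a _ (Sig.s1 (h _ p)) = _
    rw [ihp]; rfl
  | s2 p q ihp ihq =>
    refine (ha' _ (Sig.s2 p q)).trans ?_
    change a _ (Sig.s2 (h _ p) (h _ q)) = _
    rw [ihp, ihq]; rfl
  | k x y => exact ha' _ (Sig.k x y)
  | k1 y p ihp =>
    refine (ha' _ (Sig.k1 y p)).trans ?_
    change a _ (Sig.k1 y (h _ p)) = _
    rw [ihp]; rfl
  | i x => exact ha' _ (Sig.i x)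
  | choice p q ihp ihq =>
    refine (ha' _ (Sig.choice p q)).trans ?_
    change a _ (Sig.choice (h _ p) (h _ q)) = _
    rw [ihp, ihq]; rfl

/-- The action of the free monad `Σ⋆` on morphisms. -/
def Free.map {V W : TySet} (f : V ⟶ W) : Free V ⟶ Free W :=
  Free.eval (f ≫ Free.eta W) (Free.iota W)

/-- The Eilenberg-Moore algebra `â : Σ⋆ A ⟶ A` induced by a `Σ`-algebra `a : Σ A ⟶ A`. -/
def Free.hat {A : TySet} (a : SigF.obj A ⟶ A) : Free A ⟶ A :=
  Free.eval (𝟙 A) a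

/-- The sorted set `μΣ` of closed terms (programs). -/
abbrev Mu : TySet := Free ⟨fun _ => Empty⟩

/-- The `Σ`-algebra of programs. -/
def muAlg : Endofunctor.Algebra SigF := ⟨Mu, Free.iota _⟩

/-- The unique `Σ`-algebra morphism `⟦-⟧ : μΣ ⟶ A`. -/
def den (A : Endofunctor.Algebra SigF) : muAlg ⟶ A where
  f := Free.eval (fun _ x => x.elim) A.str
  h := (Free.iota_eval _ _).symm

/-- `μΣ` is the initial `Σ`-algebra. -/
def muInitial : IsInitial muAlg :=
  IsInitial.ofUniqueHom den fun _ m =>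
    Endofunctor.Algebra.Hom.ext
      (Free.eval_unique _ _ m.f (TySet.hom_ext fun _ x => x.elim) m.h.symm)

/-! ### Behaviour -/

/-- The finite distribution functor on objects. -/
abbrev Dist (X : Type) : Type := StdSimplex ℝ X

/-- The observable (non-reduction) part of the behaviour: `1` at `unit`, and `X_a → Y_b` at
`a → b`. -/
def Obs (X Y : TySet) : Ty → Type
  | .unit => Unit
  | .arr a b => X a → Y b

def Obs.map {X X' Y Y' : TySet} (f : X' ⟶ X) (g : Y ⟶ Y') : ∀ τ, Obs X Y τ → Obs X' Y' τ
  | .unit, x => x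
  | .arr a b, h => fun x => g b (h (f a x))

/-- `B_unit(X, Y) = D(Y_unit) + 1` and `B_{a → b}(X, Y) = D(Y_{a → b}) + (X_a → Y_b)`. -/
abbrev BObj (X Y : TySet) : TySet := ⟨fun τ => Dist (Y τ) ⊕ Obs X Y τ⟩

noncomputable def BMap {X X' Y Y' : TySet} (f : X' ⟶ X) (g : Y ⟶ Y') : BObj X Y ⟶ BObj X' Y' :=
  fun τ => Sum.map (StdSimplex.map (g τ)) (Obs.map f g τ)

theorem BMap_id (X Y : TySet) : BMap (𝟙 X) (𝟙 Y) = 𝟙 (BObj X Y) := by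
  refine TySet.hom_ext fun τ x => ?_
  rcases x with φ | h
  · exact congrArg Sum.inl (StdSimplex.map_id φ)
  · cases τ <;> rfl

theorem BMap_comp {X X' X'' Y Y' Y'' : TySet} (f : X' ⟶ X) (f' : X'' ⟶ X') (g : Y ⟶ Y')
    (g' : Y' ⟶ Y'') : BMap f g ≫ BMap f' g' = BMap (f' ≫ f) (g ≫ g') := by
  refine TySet.hom_ext fun τ x => ?_
  rcases x with φ | h
  · exact congrArg Sum.inl (StdSimplex.map_map φ (g τ) (g' τ))
  · cases τ <;> rfl

/-- The behaviour bifunctor of xPTCL. -/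
noncomputable def Bp : TySetᵒᵖ ⥤ TySet ⥤ TySet where
  obj X :=
    { obj := fun Y => BObj X.unop Y
      map := fun g => BMap (𝟙 X.unop) g
      map_id := fun Y => BMap_id _ Y
      map_comp := fun g g' => (BMap_comp (𝟙 X.unop) (𝟙 X.unop) g g').symm }
  map f :=
    { app := fun Y => BMap f.unop (𝟙 Y)
      naturality := fun _ _ g => (BMap_comp _ _ _ _).trans (BMap_comp f.unop (𝟙 _) (𝟙 _) g).symm }
  map_id X := by
    ext Y
    exact BMap_id X.unop Y
  map_comp f f' := by
    ext Y
    exact (BMap_comp f.unop f'.unop (𝟙 Y) (𝟙 Y)).symm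

/-! ### Higher-order GSOS laws -/

/-- A higher-order GSOS law `ρ_{X,Y} : Σ (X × B(X,Y)) ⟶ B(X, Σ⋆ (X + Y))` of the syntax functor
over a bifunctor `B`, natural in `Y` and dinatural in `X`. -/
structure GSOSLaw (B : TySetᵒᵖ ⥤ TySet ⥤ TySet) where
  app (X Y : TySet) :
    SigF.obj (prodSet X ((B.obj (op X)).obj Y)) ⟶ (B.obj (op X)).obj (Free (coprodSet X Y))
  natural (X : TySet) {Y Y' : TySet} (g : Y ⟶ Y') :
    SigF.map (prodMap (𝟙 X) ((B.obj (op X)).map g)) ≫ app X Y' =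
      app X Y ≫ (B.obj (op X)).map (Free.map (coprodMap (𝟙 X) g))
  dinatural {X X' : TySet} (f : X ⟶ X') (Y : TySet) :
    SigF.map (prodMap (𝟙 X) ((B.map f.op).app Y)) ≫ app X Y ≫
        (B.obj (op X)).map (Free.map (coprodMap f (𝟙 Y))) =
      SigF.map (prodMap f (𝟙 ((B.obj (op X')).obj Y))) ≫ app X' Y ≫
        (B.map f.op).app (Free (coprodSet X' Y))

/-- Arguments (formal variables of `X`) as terms over `X + Y`. -/
def vl {X Y : TySet} {a : Ty} (x : X a) : Tm (coprodSet X Y) a := Tm.var (Sum.inl x)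

/-- Successors (formal variables of `Y`) as terms over `X + Y`. -/
def vr {X Y : TySet} {a : Ty} (y : Y a) : Tm (coprodSet X Y) a := Tm.var (Sum.inr y)

/-- The operational rules of xPTCL. In each clause, `p.1` is an argument and `p.2` its behaviour;
`inl` is a probabilistic reduction step, `inr` is the termination signal or a function. -/
noncomputable def rho (X Y : TySet) : ∀ τ, Sig (prodSet X (BObj X Y)) τ →
    BObj X (Free (coprodSet X Y)) τ
  | _, .e => Sum.inr ()
  | _, .app (p : prodSet X (BObj X Y) (Ty.arr _ _)) q =>
      match p.2 with
      | Sum.inl φ => Sum.inl (φ.map fun p' => Tm.app (vr p') (vl q.1))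
      | Sum.inr f => Sum.inl (StdSimplex.single (vr (f q.1)))
  | _, .s _ _ _ => Sum.inr fun t => Tm.s1 (vl t)
  | _, .s1 p => Sum.inr fun t => Tm.s2 (vl p.1) (vl t)
  | _, .s2 p q => Sum.inr fun t => Tm.app (Tm.app (vl p.1) (vl t)) (Tm.app (vl q.1) (vl t))
  | _, .k _ b => Sum.inr fun t => Tm.k1 b (vl t)
  | _, .k1 _ p => Sum.inr fun _ => vl p.1
  | _, .i _ => Sum.inr fun t => vl t
  | _, .choice p q => Sum.inl (StdSimplex.duple (vl p.1) (vl q.1)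
      (by norm_num : (0 : ℝ) ≤ 1 / 2) (by norm_num : (0 : ℝ) ≤ 1 / 2) (by norm_num))

/-- The higher-order GSOS law of xPTCL. -/
noncomputable def rhoP : GSOSLaw Bp where
  app X Y := rho X Y
  natural X Y Y' g := by
    refine TySet.hom_ext fun τ x => ?_
    cases x with
    | app p q =>
      rcases p with ⟨p, φ | f⟩
      · refine congrArg Sum.inl ?_
        change StdSimplex.map _ (StdSimplex.map _ φ) = StdSimplex.map _ (StdSimplex.map _ φ)
        rw [StdSimplex.map_map, StdSimplex.map_map]
        rfl
      · refine congrArg Sum.inl (Eq.symm ?_)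
        exact StdSimplex.map_single _ _
    | choice p q =>
      refine congrArg Sum.inl (Eq.symm ?_)
      exact StdSimplex.map_duple _ _ _ _ _ _
    | _ => rfl
  dinatural f Y := by
    refine TySet.hom_ext fun τ x => ?_
    cases x with
    | app p q =>
      rcases p with ⟨p, φ | h⟩
      · refine congrArg Sum.inl ?_
        change StdSimplex.map _ (StdSimplex.map _ (StdSimplex.map _ φ)) =
          StdSimplex.map _ (StdSimplex.map _ φ)
        rw [StdSimplex.map_map, StdSimplex.map_map, StdSimplex.map_map]
        rfl
      · refine congrArg Sum.inl ((StdSimplex.map_single _ _).trans (Eq.symm ?_))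
        exact StdSimplex.map_single _ _
    | choice p q =>
      refine congrArg Sum.inl ((StdSimplex.map_duple _ _ _ _ _ _).trans (Eq.symm ?_))
      exact StdSimplex.map_duple _ _ _ _ _ _
    | _ => rfl

/-- Primitive recursion on programs: the map `h : μΣ ⟶ A` with `h ∘ ι = a ∘ Σ ⟨id, h⟩`. -/
def primrec {A : TySet} (a : SigF.obj (prodSet Mu A) ⟶ A) : Mu ⟶ A
  | _, .var x => x.elim
  | _, .e => a _ Sig.e
  | _, .app p q => a _ (Sig.app (p, primrec a _ p) (q, primrec a _ q))
  | _, .s x y z => a _ (Sig.s x y z)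
  | _, .s1 p => a _ (Sig.s1 (p, primrec a _ p))
  | _, .s2 p q => a _ (Sig.s2 (p, primrec a _ p) (q, primrec a _ q))
  | _, .k x y => a _ (Sig.k x y)
  | _, .k1 y p => a _ (Sig.k1 y (p, primrec a _ p))
  | _, .i x => a _ (Sig.i x)
  | _, .choice p q => a _ (Sig.choice (p, primrec a _ p) (q, primrec a _ q))

/-- For a `Σ`-algebra `a : Σ X ⟶ X`, the composite
`B(id, â ∘ Σ⋆ ∇) ∘ ρ_{X,X} : Σ (X × B(X,X)) ⟶ B(X,X)`. -/
def GSOSLaw.interp {B : TySetᵒᵖ ⥤ TySet ⥤ TySet} (ρ : GSOSLaw B) {X : TySet}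
    (a : SigF.obj X ⟶ X) :
    SigF.obj (prodSet X ((B.obj (op X)).obj X)) ⟶ (B.obj (op X)).obj X :=
  ρ.app X X ≫ (B.obj (op X)).map (Free.map (codiag X) ≫ Free.hat a)

/-- The operational model `γ : μΣ ⟶ B(μΣ, μΣ)` of a higher-order GSOS law. -/
def GSOSLaw.opModel {B : TySetᵒᵖ ⥤ TySet ⥤ TySet} (ρ : GSOSLaw B) : HOCoalgebra B where
  V := Mu
  str := primrec (ρ.interp muAlg.str)

/-- `(X, a, c)` is a `ρ`-bialgebra, for `X` and `c` given by a higher-order coalgebra. -/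
def GSOSLaw.IsBialgebra {B : TySetᵒᵖ ⥤ TySet ⥤ TySet} (ρ : GSOSLaw B) (P : HOCoalgebra B)
    (a : SigF.obj P.V ⟶ P.V) : Prop :=
  a ≫ P.str = SigF.map (pairing (𝟙 P.V) P.str) ≫ ρ.interp a

/-- The operational model is a `ρ`-bialgebra. -/
theorem GSOSLaw.opModel_isBialgebra {B : TySetᵒᵖ ⥤ TySet ⥤ TySet} (ρ : GSOSLaw B) :
    ρ.IsBialgebra ρ.opModel muAlg.str := by
  refine TySet.hom_ext fun τ x => ?_
  cases x <;> rfl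

/-- A denotational model is a `ρ`-bialgebra whose higher-order coalgebra is locally final. -/
def GSOSLaw.IsDenotationalModel {B : TySetᵒᵖ ⥤ TySet ⥤ TySet} (ρ : GSOSLaw B)
    (P : HOCoalgebra B) (a : SigF.obj P.V ⟶ P.V) : Prop :=
  P.IsLocallyFinal ∧ ρ.IsBialgebra P a

/-- A `Σ`-algebra is adequate if `beh`, the unique `B(μΣ, -)`-coalgebra morphism from the
operational model to the final `B(μΣ, -)`-coalgebra (which is required to exist), factorizes
through `⟦-⟧`. -/
def GSOSLaw.IsAdequate {B : TySetᵒᵖ ⥤ TySet ⥤ TySet} (ρ : GSOSLaw B)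
    (A : Endofunctor.Algebra SigF) : Prop :=
  (∃ N : Endofunctor.Coalgebra (B.obj (op Mu)), Nonempty (IsTerminal N)) ∧
    ∀ (N : Endofunctor.Coalgebra (B.obj (op Mu))) (hN : IsTerminal N),
      ∃ m : A.a ⟶ N.V, (den A).f ≫ m = (hN.from ρ.opModel.toCoalgebra).f

/-! ### Strong probabilistic applicative bisimilarity -/

/-- The operational model of xPTCL. -/
noncomputable def gammaP (τ : Ty) (p : Mu τ) : BObj Mu Mu τ := rhoP.opModel.str τ p

/-- Two distributions on programs give the same probability to each equivalence class. -/
def DistRel {X : Type} (r : Setoid X) (φ ψ : Dist X) : Prop :=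
  ∀ E ∈ r.classes, ∑ᶠ t ∈ E, φ.weights t = ∑ᶠ t ∈ E, ψ.weights t

/-- Termination signals are related; functions are related if they send each argument to
related results. -/
def ObsRel (R : ∀ τ, Setoid (Mu τ)) : ∀ τ, Obs Mu Mu τ → Obs Mu Mu τ → Prop
  | .unit, _, _ => True
  | .arr a b, f, g => ∀ t : Mu a, R b (f t) (g t)

/-- `R` is a strong probabilistic applicative bisimulation (a `Ty`-indexed equivalence relation). -/
def IsBisimulation (R : ∀ τ, Setoid (Mu τ)) : Prop :=
  ∀ τ (p q : Mu τ), R τ p q →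
    Sum.LiftRel (DistRel (R τ)) (ObsRel R τ) (gammaP τ p) (gammaP τ q)

/-- Strong probabilistic applicative bisimilarity: the supremum of all bisimulations. -/
noncomputable def Bisimilarity : ∀ τ, Setoid (Mu τ) :=
  sSup {R | IsBisimulation R}

end XPTCL

open XPTCL

/-!
At each sort, `B(X, -)` is `D(-) + K` for a set `K` of observations, and a coalgebra of `B(X, -)`
is final if and only if all its components are final for these functors of sets. As the
observations at `a → b` involve only the carriers at `a` and `b`, both final and locally final
coalgebras arise by recursion on the sort from the final coalgebras of `D(-) + K`, and uniqueness
of locally final coalgebras is an induction on the sort.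

Kernels of maps `f` out of the programs are bisimulations precisely when `B(id, f) ∘ γ` respects
them. So the kernel of `beh` is a bisimulation, and it contains any bisimulation `R` because `beh`
factors through the quotient coalgebra by `R`.

The operational rules prescribe the behaviour of every operation on a locally final coalgebra,
where application is defined by primitive corecursion. In any bialgebra, `B(id, ⟦-⟧) ∘ γ` and
`B(⟦-⟧, id) ∘ c ∘ ⟦-⟧` satisfy the same primitive recursion over programs, by naturality and
dinaturality of `ρ`. So `⟦-⟧` is a morphism of higher-order coalgebras, and hence `beh` factors
through it.
-/

namespace HOCoalgebra

universe v u

variable {C : Type u} [Category.{v} C] {B : Cᵒᵖ ⥤ C ⥤ C} {P Q : HOCoalgebra B}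

/-- An isomorphism of carriers that respects the structures in both arguments of `B`, as a
morphism of higher-order coalgebras. -/
def homOfIso (e : P.V ≅ Q.V) (w : P.str ≫ (B.map e.inv.op).app P.V ≫
    (B.obj (op Q.V)).map e.hom = e.hom ≫ Q.str) : P ⟶ Q where
  f := e.hom
  h := by
    rw [← reassoc_of% w, (B.map e.hom.op).naturality, ← NatTrans.comp_app_assoc, ← B.map_comp,
      ← op_comp, e.hom_inv_id, op_id, B.map_id, NatTrans.id_app, Category.id_comp]

/-- An isomorphism of carriers that respects the structures in both arguments of `B`, as an
isomorphism of higher-order coalgebras. -/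
def isoMk (e : P.V ≅ Q.V) (w : P.str ≫ (B.map e.inv.op).app P.V ≫
    (B.obj (op Q.V)).map e.hom = e.hom ≫ Q.str) : P ≅ Q where
  hom := homOfIso e w
  inv := homOfIso e.symm <| by
    rw [← Iso.inv_comp_eq] at w
    simp [← w, ← Functor.map_comp]
  hom_inv_id := Hom.ext e.hom_inv_id
  inv_hom_id := Hom.ext e.inv_hom_id

/-- The coalgebra of `B(X, -)` obtained from a higher-order coalgebra by precomposing its
behaviour with `f : X ⟶ Q.V` in the contravariant argument. -/
def restrict (Q : HOCoalgebra B) {X : C} (f : X ⟶ Q.V) : Endofunctor.Coalgebra (B.obj (op X)) :=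
  ⟨Q.V, Q.str ≫ (B.map f.op).app Q.V⟩

theorem hom_comp_from_restrict (m : P ⟶ Q) {N : Endofunctor.Coalgebra (B.obj (op P.V))}
    (hN : IsTerminal N) :
    m.f ≫ (hN.from (Q.restrict m.f)).f = (hN.from P.toCoalgebra).f :=
  let m' : P.toCoalgebra ⟶ Q.restrict m.f := ⟨m.f, m.h⟩
  congrArg Endofunctor.Coalgebra.Hom.f (hN.hom_ext (m' ≫ hN.from _) (hN.from _))

end HOCoalgebra

namespace XPTCL

section Coalgebra

universe v u

variable {C : Type u} [Category.{v} C] {F G : C ⥤ C}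

/-- The isomorphism between the carriers of terminal coalgebras of isomorphic endofunctors. -/
noncomputable def isoOfIsTerminal {A : Endofunctor.Coalgebra F} {B : Endofunctor.Coalgebra G}
    (hA : IsTerminal A) (hB : IsTerminal B) (α : F ≅ G) : A.V ≅ B.V :=
  (Endofunctor.Coalgebra.forget G).mapIso <|
    (hA.isTerminalObj (Endofunctor.Coalgebra.equivOfNatIso α).functor A).uniqueUpToIso hB

theorem str_comp_isoOfIsTerminal_hom {A : Endofunctor.Coalgebra F} {B : Endofunctor.Coalgebra G}
    (hA : IsTerminal A) (hB : IsTerminal B) (α : F ≅ G) :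
    A.str ≫ α.hom.app A.V ≫ G.map (isoOfIsTerminal hA hB α).hom =
      (isoOfIsTerminal hA hB α).hom ≫ B.str :=
  (Category.assoc _ _ _).symm.trans
    ((hA.isTerminalObj (Endofunctor.Coalgebra.equivOfNatIso α).functor A).uniqueUpToIso hB).hom.h

/-- A coalgebra whose structure corresponds to that of a terminal coalgebra, along an isomorphism
of endofunctors and an isomorphism of carriers, is terminal. -/
noncomputable def isTerminalOfIso {A : Endofunctor.Coalgebra F} {B : Endofunctor.Coalgebra G}
    (hB : IsTerminal B) (α : F ≅ G) (e : A.V ≅ B.V)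
    (w : A.str ≫ α.hom.app A.V ≫ G.map e.hom = e.hom ≫ B.str) : IsTerminal A :=
  let E := Endofunctor.Coalgebra.equivOfNatIso α
  let i : E.functor.obj A ≅ B :=
    Endofunctor.Coalgebra.isoMk e ((Category.assoc _ _ _).trans w)
  (hB.ofIso i.symm).isTerminalOfObj E.functor A

variable {W : Endofunctor.Coalgebra F} (hW : IsTerminal W) {X : C} [HasBinaryCoproduct X W.V]

/-- Primitive corecursion into the terminal coalgebra `W`: in each step, the coalgebra `c` either
continues with a state in `X` or stops with an element of `W`. -/
noncomputable def primCorec (c : X ⟶ F.obj (X ⨿ W.V)) : X ⟶ W.V :=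
  coprod.inl ≫ (hW.from ⟨X ⨿ W.V, coprod.desc c (W.str ≫ F.map coprod.inr)⟩).f

theorem primCorec_comp_str (c : X ⟶ F.obj (X ⨿ W.V)) :
    primCorec hW c ≫ W.str = c ≫ F.map (coprod.desc (primCorec hW c) (𝟙 W.V)) := by
  let S : Endofunctor.Coalgebra F := ⟨X ⨿ W.V, coprod.desc c (W.str ≫ F.map coprod.inr)⟩
  let inr : W ⟶ S := ⟨coprod.inr, (coprod.inr_desc _ _).symm⟩
  have inr_from : coprod.inr ≫ (hW.from S).f = 𝟙 W.V :=
    congrArg Endofunctor.Coalgebra.Hom.f (hW.hom_ext (inr ≫ hW.from S) (𝟙 W))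
  have from_eq : (hW.from S).f = coprod.desc (primCorec hW c) (𝟙 W.V) := by
    refine coprod.hom_ext ?_ ?_
    · rw [coprod.inl_desc]; rfl
    · rw [coprod.inr_desc, inr_from]
  calc primCorec hW c ≫ W.str = coprod.inl ≫ S.str ≫ F.map (hW.from S).f := by
        rw [(hW.from S).h]; exact Category.assoc _ _ _
    _ = c ≫ F.map (coprod.desc (primCorec hW c) (𝟙 W.V)) := by
        rw [from_eq]; exact coprod.inl_desc_assoc _ _ _

end Coalgebra

section Simplex

variable {R X : Type*} [PartialOrder R] [Semiring R] [IsStrictOrderedRing R]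

theorem map_congr_of_eqOn_support (φ : StdSimplex R X) {Y : Type*} {f g : X → Y}
    (h : Set.EqOn f g φ.weights.support) : φ.map f = φ.map g :=
  StdSimplex.ext (Finsupp.mapDomain_congr h)

theorem exists_map_nat_eq (φ : StdSimplex R X) :
    ∃ (ψ : StdSimplex R ℕ) (f : ℕ → X), ψ.map f = φ := by
  obtain ⟨f, hf⟩ := φ.weights.support.countable_toSet.exists_eq_range
    (Finset.coe_nonempty.2 φ.support_weights_nonempty)
  have : Nonempty X := ⟨f 0⟩
  have hinv : Set.EqOn (fun x => f (Function.invFun f x)) id φ.weights.support := fun x hx =>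
    Function.invFun_eq (hf ▸ hx : x ∈ Set.range f)
  exact ⟨φ.map (Function.invFun f), f, by
    rw [StdSimplex.map_map, map_congr_of_eqOn_support φ hinv, StdSimplex.map_id]⟩

end Simplex

section Cofix

universe u

variable (F : Type u → Type u) [QPF F] [LawfulFunctor F]

/-- The greatest fixed point of a quotient of a polynomial functor, as a coalgebra. -/
def cofixCoalgebra : Endofunctor.Coalgebra (ofTypeFunctor F) :=
  ⟨QPF.Cofix F, ↾QPF.Cofix.dest⟩

variable {F} in
theorem eq_cofix_corec {A : Type u} (c : A → F A) {g : A → QPF.Cofix F}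
    (hg : ∀ x, QPF.Cofix.dest (g x) = g <$> c x) : g = QPF.Cofix.corec c := by
  funext x
  refine QPF.Cofix.bisim_rel (fun u v => ∃ x, u = g x ∧ v = QPF.Cofix.corec c x) ?_ _ _
    ⟨x, rfl, rfl⟩
  rintro _ _ ⟨x, rfl, rfl⟩
  rw [hg, QPF.Cofix.dest_corec, Functor.map_map, Functor.map_map]
  congr 1
  exact funext fun y => Quot.sound ⟨y, rfl, rfl⟩

/-- `cofixCoalgebra F` is the final coalgebra of `F`. -/
def isTerminalCofixCoalgebra : IsTerminal (cofixCoalgebra F) :=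
  IsTerminal.ofUniqueHom
    (fun A => ⟨↾(QPF.Cofix.corec (F := F) A.str), by
      ext x; exact (QPF.Cofix.dest_corec (F := F) A.str x).symm⟩)
    fun A m => by
      ext x
      exact congrFun (eq_cofix_corec (F := F) A.str
        fun y => (ConcreteCategory.congr_hom m.h y).symm) x

end Cofix

section DistSum

/-- The functor `Y ↦ D(Y) + K`. -/
def DistSum (K Y : Type) : Type := Dist Y ⊕ K

variable (K : Type)

noncomputable instance : Functor (DistSum K) where
  map f := Sum.map (StdSimplex.map f) id

/-- Distributions are finitely supported, hence images of distributions on `ℕ`; so `DistSum K` is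
a quotient of the polynomial functor with shapes `D(ℕ) + K`. -/
noncomputable instance : QPF (DistSum K) where
  P := ⟨Dist ℕ ⊕ K, Sum.elim (fun _ => ℕ) (fun _ => Empty)⟩
  abs
    | ⟨Sum.inl ψ, f⟩ => Sum.inl (ψ.map f)
    | ⟨Sum.inr k, _⟩ => Sum.inr k
  repr
    | Sum.inl φ => ⟨Sum.inl (exists_map_nat_eq φ).choose,
        (exists_map_nat_eq φ).choose_spec.choose⟩
    | Sum.inr k => ⟨Sum.inr k, Empty.elim⟩
  abs_repr
    | Sum.inl φ => congrArg Sum.inl (exists_map_nat_eq φ).choose_spec.choose_spec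
    | Sum.inr _ => rfl
  abs_map f
    | ⟨Sum.inl ψ, g⟩ => congrArg Sum.inl (StdSimplex.map_map ψ g f).symm
    | ⟨Sum.inr _, _⟩ => rfl

instance : LawfulFunctor (DistSum K) :=
  QPF.lawfulFunctor fun _ _ => rfl

/-- The bifunctor `(K, Y) ↦ D(Y) + K`. -/
noncomputable def distSum : Type ⥤ Type ⥤ Type where
  obj K := ofTypeFunctor (DistSum K)
  map k := { app := fun Y => ↾(Sum.map id k), naturality := by rintro X Y f; ext (x | x) <;> rfl }
  map_id K := by ext Y (x | x) <;> rfl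
  map_comp k l := by ext Y (x | x) <;> rfl

/-- The carrier of the final coalgebra of `D(-) + K`. -/
abbrev NuDist : Type := QPF.Cofix (DistSum K)

end DistSum

section Sortwise

/-- The observations at a sort, as a functor of the results. -/
def obsFunctor (X : TySet) (τ : Ty) : TySet ⥤ Type where
  obj Y := Obs X Y τ
  map g := ↾(Obs.map (𝟙 X) g τ)
  map_id Y := by cases τ <;> rfl
  map_comp f g := by cases τ <;> rfl

/-- The sort `τ` of a sorted set, as a functor. -/
def sortFunctor (τ : Ty) : TySet ⥤ Type where
  obj X := X τ
  map f := ↾(f τ)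

variable {X : TySet}

/-- The component of a coalgebra of `B(X, -)` at the sort `τ`, where `B(X, -)` becomes `D(-) + K`
for the set `K` of observations at `τ`. -/
noncomputable def sortCoalg (A : Endofunctor.Coalgebra (Bp.obj (op X))) (τ : Ty) :
    Endofunctor.Coalgebra (distSum.obj ((obsFunctor X τ).obj A.V)) :=
  ⟨A.V τ, ↾(A.str τ)⟩

/-- Changes the constant `K` of a coalgebra of `D(-) + K`. -/
noncomputable def relabel {K L : Type} (k : K → L) (A : Endofunctor.Coalgebra (distSum.obj K)) :
    Endofunctor.Coalgebra (distSum.obj L) :=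
  (Endofunctor.Coalgebra.functorOfNatTrans (distSum.map (↾k))).obj A

theorem distSum_map_obs_comp {Y Y' : TySet} (f : Y ⟶ Y') (τ : Ty) (x : BObj X Y τ) :
    ((distSum.obj _).map (↾(f τ))) ((distSum.map ((obsFunctor X τ).map f)).app (Y τ) x) =
      BMap (𝟙 X) f τ x :=
  Sum.map_map (f' := StdSimplex.map (f τ)) (g' := id) _ _ x

variable {A P : Endofunctor.Coalgebra (Bp.obj (op X))}

/-- The component of a coalgebra morphism at a sort. -/
noncomputable def sortHom (m : A ⟶ P) (τ : Ty) :
    relabel (Obs.map (𝟙 X) m.f τ) (sortCoalg A τ) ⟶ sortCoalg P τ where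
  f := ↾(m.f τ)
  h := by
    ext x
    exact (distSum_map_obs_comp m.f τ _).trans (congrFun (congrFun m.h τ) x)

theorem map_str_of_sortHom (f : A.V ⟶ P.V) (τ : Ty)
    (h : relabel (Obs.map (𝟙 X) f τ) (sortCoalg A τ) ⟶ sortCoalg P τ) (hf : f τ = h.f)
    (x : A.V τ) : BMap (𝟙 X) f τ (A.str τ x) = P.str τ (f τ x) := by
  have hx : (distSum.obj _).map h.f
      ((distSum.map ((obsFunctor X τ).map f)).app (A.V τ) (A.str τ x)) = P.str τ (h.f x) :=
    ConcreteCategory.congr_hom h.h x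
  rw [show h.f = ↾(f τ) from congrArg (↾·) hf.symm] at hx
  exact (distSum_map_obs_comp f τ _).symm.trans hx

variable (hP : ∀ τ, IsTerminal (sortCoalg P τ))

/-- The coalgebra morphism into a sortwise terminal coalgebra. It is defined by recursion on the
sort, since the observations at `a → b` depend on the morphism at `b`. -/
noncomputable def sortLift (A : Endofunctor.Coalgebra (Bp.obj (op X))) : ∀ τ, A.V τ → P.V τ
  | .unit => ((hP .unit).from (relabel (K := Unit) id (sortCoalg A .unit))).f
  | .arr a b => ((hP (.arr a b)).from (relabel (K := X a → A.V b)
      (fun h y => sortLift A b (h y)) (sortCoalg A (.arr a b)))).f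

theorem sortLift_eq_from (τ : Ty) :
    sortLift hP A τ =
      ((hP τ).from (relabel (Obs.map (𝟙 X) (sortLift hP A) τ) (sortCoalg A τ))).f := by
  cases τ <;> rfl

/-- `sortLift` as a coalgebra morphism. -/
noncomputable def sortLiftHom (A : Endofunctor.Coalgebra (Bp.obj (op X))) : A ⟶ P where
  f := sortLift hP A
  h := TySet.hom_ext fun τ => map_str_of_sortHom _ τ _ (sortLift_eq_from hP τ)

theorem eq_sortLiftHom (m : A ⟶ P) : m = sortLiftHom hP A := by
  refine Endofunctor.Coalgebra.Hom.ext (funext fun τ => ?_)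
  have m_eq_from (τ : Ty) : m.f τ =
      ((hP τ).from (relabel (Obs.map (𝟙 X) m.f τ) (sortCoalg A τ))).f :=
    congrArg (fun h => (h.f : A.V τ → P.V τ)) ((hP τ).hom_ext (sortHom m τ) ((hP τ).from _))
  induction τ with
  | unit => exact m_eq_from .unit
  | arr a b _ ih =>
    have ih : m.f b = sortLift hP A b := ih
    rw [m_eq_from]
    change _ = sortLift hP A (.arr a b)
    rw [sortLift, ← ih]
    rfl

/-- A sortwise terminal coalgebra is terminal. -/
noncomputable def isTerminalOfSortCoalg : IsTerminal P :=
  IsTerminal.ofUniqueHom (sortLiftHom hP) fun _ => eq_sortLiftHom hP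

end Sortwise

section Final

/-- The carrier of the final coalgebra of `B(X, -)`. -/
def NuEl (X : TySet) : Ty → Type
  | .unit => NuDist Unit
  | .arr a b => NuDist (X a → NuEl X b)

/-- The final coalgebra of `B(X, -)`. -/
noncomputable def nuCoalg (X : TySet) : Endofunctor.Coalgebra (Bp.obj (op X)) where
  V := ⟨NuEl X⟩
  str
    | .unit => QPF.Cofix.dest (F := DistSum Unit)
    | .arr a b => QPF.Cofix.dest (F := DistSum (X a → NuEl X b))

/-- The components of `nuCoalg X` are final. -/
noncomputable def isTerminalSortNuCoalg (X : TySet) : ∀ τ, IsTerminal (sortCoalg (nuCoalg X) τ)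
  | .unit => isTerminalCofixCoalgebra (DistSum Unit)
  | .arr a b => isTerminalCofixCoalgebra (DistSum (X a → NuEl X b))

/-- `nuCoalg X` is final. -/
noncomputable def isTerminalNuCoalg (X : TySet) : IsTerminal (nuCoalg X) :=
  isTerminalOfSortCoalg (isTerminalSortNuCoalg X)

/-- A terminal coalgebra is sortwise terminal. -/
noncomputable def isTerminalSortCoalg {X : TySet} {P : Endofunctor.Coalgebra (Bp.obj (op X))}
    (hP : IsTerminal P) (τ : Ty) : IsTerminal (sortCoalg P τ) :=
  let i := hP.uniqueUpToIso (isTerminalNuCoalg X)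
  let e := (Endofunctor.Coalgebra.forget _).mapIso i
  isTerminalOfIso (isTerminalSortNuCoalg X τ) (distSum.mapIso ((obsFunctor X τ).mapIso e))
    ((sortFunctor τ).mapIso e) ((Category.assoc _ _ _).symm.trans (sortHom i.hom τ).h)

/-- The carrier of the locally final coalgebra. -/
def LocEl : Ty → Type
  | .unit => NuDist Unit
  | .arr a b => NuDist (LocEl a → LocEl b)

/-- A locally final coalgebra. -/
noncomputable def locCoalg : HOCoalgebra Bp where
  V := ⟨LocEl⟩
  str
    | .unit => QPF.Cofix.dest (F := DistSum Unit)
    | .arr a b => QPF.Cofix.dest (F := DistSum (LocEl a → LocEl b))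

theorem isLocallyFinal_locCoalg : locCoalg.IsLocallyFinal :=
  ⟨isTerminalOfSortCoalg fun
    | .unit => isTerminalCofixCoalgebra (DistSum Unit)
    | .arr a b => isTerminalCofixCoalgebra (DistSum (LocEl a → LocEl b))⟩

end Final

section Uniqueness

variable {Z Z' : HOCoalgebra Bp} (hZ : IsTerminal Z.toCoalgebra)
  (hZ' : IsTerminal Z'.toCoalgebra)

/-- The carriers of two locally final coalgebras agree sort by sort, since the constant part of
the behaviour at `a → b` is determined by the carriers at `a` and `b`. -/
noncomputable def locEquiv : ∀ τ, Z.V τ ≃ Z'.V τ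
  | .unit => (isoOfIsTerminal (isTerminalSortCoalg hZ .unit) (isTerminalSortCoalg hZ' .unit)
      (Iso.refl (distSum.obj Unit))).toEquiv
  | .arr a b => (isoOfIsTerminal (isTerminalSortCoalg hZ (.arr a b))
      (isTerminalSortCoalg hZ' (.arr a b))
      (distSum.mapIso ((locEquiv a).arrowCongr (locEquiv b)).toIso)).toEquiv

/-- `locEquiv` as an isomorphism of sorted sets. -/
noncomputable def locIso : Z.V ≅ Z'.V where
  hom τ := locEquiv hZ hZ' τ
  inv τ := (locEquiv hZ hZ' τ).symm
  hom_inv_id := TySet.hom_ext fun τ x => (locEquiv hZ hZ' τ).symm_apply_apply x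
  inv_hom_id := TySet.hom_ext fun τ x => (locEquiv hZ hZ' τ).apply_symm_apply x

theorem BMap_locIso_str (τ : Ty) (x : Z.V τ) :
    BMap (locIso hZ hZ').inv (locIso hZ hZ').hom τ (Z.str τ x) =
      Z'.str τ ((locIso hZ hZ').hom τ x) := by
  cases τ with
  | unit =>
    exact ConcreteCategory.congr_hom (str_comp_isoOfIsTerminal_hom
      (isTerminalSortCoalg hZ .unit) (isTerminalSortCoalg hZ' .unit)
      (Iso.refl (distSum.obj Unit))) x
  | arr a b =>
    refine (Sum.map_map (f' := StdSimplex.map ((locIso hZ hZ').hom _)) (g' := id) _ _ _).symm.trans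
      ?_
    exact ConcreteCategory.congr_hom (str_comp_isoOfIsTerminal_hom
      (isTerminalSortCoalg hZ (.arr a b)) (isTerminalSortCoalg hZ' (.arr a b))
      (distSum.mapIso ((locEquiv hZ hZ' a).arrowCongr (locEquiv hZ hZ' b)).toIso)) x

include hZ hZ' in
theorem nonempty_iso_of_isTerminal : Nonempty (Z ≅ Z') := by
  refine ⟨HOCoalgebra.isoMk (locIso hZ hZ') (TySet.hom_ext fun τ x => ?_)⟩
  refine Eq.trans ?_ (BMap_locIso_str hZ hZ' τ x)
  exact congrFun (congrFun (BMap_comp (locIso hZ hZ').inv (𝟙 _) (𝟙 _) (locIso hZ hZ').hom) τ) _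

end Uniqueness

section Adequacy

theorem Free.eval_comp {V A A' : TySet} (v : V ⟶ A) {a : SigF.obj A ⟶ A} {a' : SigF.obj A' ⟶ A'}
    {f : A ⟶ A'} (hf : a ≫ f = SigF.map f ≫ a') : Free.eval v a ≫ f = Free.eval (v ≫ f) a' :=
  Free.eval_unique _ _ _ rfl <| by
    rw [← Category.assoc, Free.iota_eval, Category.assoc, hf, Functor.map_comp, Category.assoc]

theorem Free.map_comp_eval {V W A : TySet} (f : V ⟶ W) (v : W ⟶ A) (a : SigF.obj A ⟶ A) :
    Free.map f ≫ Free.eval v a = Free.eval (f ≫ v) a :=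
  Free.eval_comp _ (Free.iota_eval v a)

theorem mu_hom_ext_of_primrec {A : TySet} (k : SigF.obj (prodSet Mu A) ⟶ A) {u v : Mu ⟶ A}
    (hu : muAlg.str ≫ u = SigF.map (pairing (𝟙 Mu) u) ≫ k)
    (hv : muAlg.str ≫ v = SigF.map (pairing (𝟙 Mu) v) ≫ k) : u = v := by
  let fst : prodSet Mu A ⟶ Mu := fun _ => Prod.fst
  have pairing_eq {w : Mu ⟶ A} (hw : muAlg.str ≫ w = SigF.map (pairing (𝟙 Mu) w) ≫ k) :
      pairing (𝟙 Mu) w = Free.eval (V := ⟨fun _ => Empty⟩) (fun _ x => x.elim)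
        (pairing (SigF.map fst ≫ muAlg.str) k) := by
    refine Free.eval_unique _ _ _ (TySet.hom_ext fun _ x => x.elim) ?_
    refine TySet.hom_ext fun τ x => Prod.ext ?_ (congrFun (congrFun hw τ) x)
    have map_fst : SigF.map (pairing (𝟙 Mu) w) ≫ SigF.map fst = 𝟙 _ :=
      (SigF.map_comp _ _).symm.trans (SigF.map_id Mu)
    exact congrArg (muAlg.str τ) (congrFun (congrFun map_fst τ) x).symm
  exact congrArg (fun w : Mu ⟶ prodSet Mu A => fun τ t => (w τ t).2)
    ((pairing_eq hu).trans (pairing_eq hv).symm)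

namespace GSOSLaw

variable {B : TySetᵒᵖ ⥤ TySet ⥤ TySet} {ρ : GSOSLaw B}

/-- The interpretation of the rules with arguments in `X` and successors in a `Σ`-algebra `A`,
where arguments are sent to `A` by `h`. Both `⟦-⟧` followed by the restricted behaviour and `γ`
followed by `B(id, ⟦-⟧)` are primitively recursive for it. -/
def interpAlong (ρ : GSOSLaw B) {X A : TySet} (h : X ⟶ A) (a : SigF.obj A ⟶ A) :
    SigF.obj (prodSet X ((B.obj (op X)).obj A)) ⟶ (B.obj (op X)).obj A :=
  ρ.app X A ≫ (B.obj (op X)).map (Free.eval (coprodMap h (𝟙 A) ≫ codiag A) a)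

theorem interp_eq_interpAlong_id {A : TySet} (a : SigF.obj A ⟶ A) :
    ρ.interp a = ρ.interpAlong (𝟙 A) a := by
  have coprodMap_id : coprodMap (𝟙 A) (𝟙 A) = 𝟙 _ :=
    TySet.hom_ext fun _ x => by rcases x with x | x <;> rfl
  rw [interp, interpAlong, Free.hat, Free.map_comp_eval, coprodMap_id, Category.id_comp,
    Category.comp_id]

namespace IsBialgebra

variable {P Q : HOCoalgebra B} {a : SigF.obj P.V ⟶ P.V} {b : SigF.obj Q.V ⟶ Q.V} {h : Q.V ⟶ P.V}

theorem comp_str_comp_map (hQ : ρ.IsBialgebra Q b) (hh : b ≫ h = SigF.map h ≫ a) :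
    b ≫ Q.str ≫ (B.obj (op Q.V)).map h =
      SigF.map (pairing (𝟙 Q.V) (Q.str ≫ (B.obj (op Q.V)).map h)) ≫ ρ.interpAlong h a := by
  have copairing_comp : (coprodMap (𝟙 Q.V) (𝟙 Q.V) ≫ codiag Q.V) ≫ h =
      coprodMap (𝟙 Q.V) h ≫ coprodMap h (𝟙 P.V) ≫ codiag P.V :=
    TySet.hom_ext fun _ x => by rcases x with x | x <;> rfl
  have pairing_comp : pairing (𝟙 Q.V) (Q.str ≫ (B.obj (op Q.V)).map h) =
    pairing (𝟙 Q.V) Q.str ≫ prodMap (𝟙 Q.V) ((B.obj (op Q.V)).map h) := rfl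
  rw [IsBialgebra, interp_eq_interpAlong_id, interpAlong] at hQ
  rw [reassoc_of% hQ, pairing_comp, Functor.map_comp_assoc, interpAlong, reassoc_of% ρ.natural,
    ← Functor.map_comp, ← Functor.map_comp, Free.eval_comp _ hh, Free.map_comp_eval,
    copairing_comp]

theorem comp_hom_comp_str (hP : ρ.IsBialgebra P a) (hh : b ≫ h = SigF.map h ≫ a) :
    b ≫ h ≫ P.str ≫ (B.map h.op).app P.V =
      SigF.map (pairing (𝟙 Q.V) (h ≫ P.str ≫ (B.map h.op).app P.V)) ≫ ρ.interpAlong h a := by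
  have comp_pairing : h ≫ pairing (𝟙 P.V) P.str =
    pairing (𝟙 Q.V) (h ≫ P.str) ≫ prodMap h (𝟙 _) := rfl
  have pairing_comp : pairing (𝟙 Q.V) (h ≫ P.str ≫ (B.map h.op).app P.V) =
    pairing (𝟙 Q.V) (h ≫ P.str) ≫ prodMap (𝟙 Q.V) ((B.map h.op).app P.V) := rfl
  have coprodMap_comp : coprodMap h (𝟙 P.V) ≫ coprodMap (𝟙 P.V) (𝟙 P.V) =
      coprodMap h (𝟙 P.V) :=
    TySet.hom_ext fun _ x => by rcases x with x | x <;> rfl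
  rw [IsBialgebra, interp_eq_interpAlong_id, interpAlong] at hP
  rw [reassoc_of% hh, reassoc_of% hP, ← Functor.map_comp_assoc, comp_pairing, pairing_comp,
    Functor.map_comp_assoc, (B.map h.op).naturality, ← reassoc_of% ρ.dinatural,
    Functor.map_comp_assoc, interpAlong, ← Functor.map_comp, Free.map_comp_eval,
    reassoc_of% coprodMap_comp]

/-- The map `⟦-⟧` into a bialgebra, as a morphism of higher-order coalgebras. -/
def denHom (hP : ρ.IsBialgebra P a) : ρ.opModel ⟶ P where
  f := (den ⟨P.V, a⟩).f
  h := mu_hom_ext_of_primrec (ρ.interpAlong (den ⟨P.V, a⟩).f a)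
    (comp_str_comp_map ρ.opModel_isBialgebra (den ⟨P.V, a⟩).h.symm)
    (comp_hom_comp_str (Q := ρ.opModel) (b := muAlg.str) hP (den ⟨P.V, a⟩).h.symm)

theorem isAdequate (hP : ρ.IsBialgebra P a) {N : Endofunctor.Coalgebra (B.obj (op Mu))}
    (hN : IsTerminal N) : ρ.IsAdequate ⟨P.V, a⟩ :=
  ⟨⟨N, ⟨hN⟩⟩, fun _ hN' => ⟨_, HOCoalgebra.hom_comp_from_restrict hP.denHom hN'⟩⟩

end IsBialgebra

end GSOSLaw

end Adequacy

section Bisimilarity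

theorem mapDomain_apply_eq_finsum {X Y M : Type*} [AddCommMonoid M] (f : X → Y) (w : X →₀ M)
    (a : X) : Finsupp.mapDomain f w (f a) = ∑ᶠ x ∈ {x | f x = f a}, w x := by
  classical
  rw [Finsupp.mapDomain_apply_eq_sum, ← finsum_mem_coe_finset]
  refine finsum_mem_inter_support_eq' _ _ _ fun x hx => ?_
  simpa using fun _ => hx

theorem distRel_ker_iff {X Y : Type} (f : X → Y) (φ ψ : Dist X) :
    DistRel (Setoid.ker f) φ ψ ↔ φ.map f = ψ.map f := by
  have map_weights_apply (χ : Dist X) (a : X) :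
      (χ.map f).weights (f a) = ∑ᶠ x ∈ {x | f x = f a}, χ.weights x := by
    rw [StdSimplex.weights_map, mapDomain_apply_eq_finsum]
  constructor
  · intro h
    ext y
    by_cases hy : y ∈ Set.range f
    · obtain ⟨a, rfl⟩ := hy
      rw [map_weights_apply, map_weights_apply]
      exact h _ ⟨a, rfl⟩
    · rw [StdSimplex.weights_map, StdSimplex.weights_map, Finsupp.mapDomain_of_notMem_range _ _ hy,
        Finsupp.mapDomain_of_notMem_range _ _ hy]
  · rintro h _ ⟨a, rfl⟩
    have weights_eq : (φ.map f).weights (f a) = (ψ.map f).weights (f a) := by rw [h]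
    rwa [map_weights_apply, map_weights_apply] at weights_eq

theorem obsRel_ker_iff {Y : TySet} (f : Mu ⟶ Y) (τ : Ty) (u v : Obs Mu Mu τ) :
    ObsRel (fun τ => Setoid.ker (f τ)) τ u v ↔ Obs.map (𝟙 Mu) f τ u = Obs.map (𝟙 Mu) f τ v := by
  cases τ with
  | unit => exact iff_of_true trivial rfl
  | arr a b => exact funext_iff.symm

theorem isBisimulation_ker_iff {Y : TySet} (f : Mu ⟶ Y) :
    IsBisimulation (fun τ => Setoid.ker (f τ)) ↔ ∀ τ p q, f τ p = f τ q →
      BMap (𝟙 Mu) f τ (gammaP τ p) = BMap (𝟙 Mu) f τ (gammaP τ q) := by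
  have liftRel_iff (τ : Ty) (u v : BObj Mu Mu τ) :
      Sum.LiftRel (DistRel (Setoid.ker (f τ))) (ObsRel (fun τ => Setoid.ker (f τ)) τ) u v ↔
        BMap (𝟙 Mu) f τ u = BMap (𝟙 Mu) f τ v := by
    rcases u with φ | u <;> rcases v with ψ | v <;>
      simp [BMap, distRel_ker_iff, obsRel_ker_iff]
  exact forall₃_congr fun τ p q => imp_congr_right fun _ => liftRel_iff τ _ _

variable {R : ∀ τ, Setoid (Mu τ)}

/-- The quotient of the set of programs by a sorted equivalence relation. -/
abbrev quotSet (R : ∀ τ, Setoid (Mu τ)) : TySet := ⟨fun τ => Quotient (R τ)⟩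

/-- The projection to the quotient. -/
def quotMap (R : ∀ τ, Setoid (Mu τ)) : Mu ⟶ quotSet R := fun _ => Quotient.mk _

theorem IsBisimulation.BMap_quotMap_eq (hR : IsBisimulation R) (τ : Ty) (p q : Mu τ)
    (h : R τ p q) : BMap (𝟙 Mu) (quotMap R) τ (gammaP τ p) =
      BMap (𝟙 Mu) (quotMap R) τ (gammaP τ q) := by
  have ker_quotMap : (fun τ => Setoid.ker (quotMap R τ)) = R :=
    funext fun τ => Setoid.ker_mk_eq (R τ)
  exact (isBisimulation_ker_iff (quotMap R)).1 (by rwa [ker_quotMap]) τ p q (Quotient.sound h)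

/-- The quotient of the operational model by a bisimulation. -/
noncomputable def quotCoalg (hR : IsBisimulation R) :
    Endofunctor.Coalgebra (Bp.obj (op Mu)) where
  V := quotSet R
  str := fun τ => Quotient.lift _ (hR.BMap_quotMap_eq τ)

/-- The projection to the quotient, as a coalgebra morphism. -/
noncomputable def quotHom (hR : IsBisimulation R) : rhoP.opModel.toCoalgebra ⟶ quotCoalg hR where
  f := quotMap R
  h := rfl

variable {N : Endofunctor.Coalgebra (Bp.obj (op Mu))} (hN : IsTerminal N)

/-- Behavioural equivalence: the kernel of the map `beh` to the final coalgebra. -/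
noncomputable def behKer : ∀ τ, Setoid (Mu τ) :=
  fun τ => Setoid.ker ((hN.from rhoP.opModel.toCoalgebra).f τ)

theorem isGreatest_behKer : IsGreatest {R | IsBisimulation R} (behKer hN) := by
  constructor
  · refine (isBisimulation_ker_iff _).2 fun τ p q h => ?_
    have hom_apply (x : Mu τ) := congrFun (congrFun (hN.from rhoP.opModel.toCoalgebra).h τ) x
    exact (hom_apply p).trans ((congrArg (N.str τ) h).trans (hom_apply q).symm)
  · intro R hR τ p q h
    have beh_eq := hN.hom_ext (quotHom hR ≫ hN.from (quotCoalg hR)) (hN.from _)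
    change (hN.from rhoP.opModel.toCoalgebra).f τ p = (hN.from rhoP.opModel.toCoalgebra).f τ q
    rw [← beh_eq]
    exact congrArg ((hN.from (quotCoalg hR)).f τ) (Quotient.sound h)

theorem bisimilarity_eq_behKer : Bisimilarity = behKer hN :=
  (isGreatest_behKer hN).isLUB.sSup_eq

theorem beh_eq_iff_bisimilarity (τ : Ty) (p q : Mu τ) :
    (hN.from rhoP.opModel.toCoalgebra).f τ p = (hN.from rhoP.opModel.toCoalgebra).f τ q ↔
      Bisimilarity τ p q := by
  rw [bisimilarity_eq_behKer hN]
  exact Iff.rfl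

theorem isGreatest_bisimilarity : IsGreatest {R | IsBisimulation R} Bisimilarity :=
  bisimilarity_eq_behKer (isTerminalNuCoalg Mu) ▸ isGreatest_behKer (isTerminalNuCoalg Mu)

theorem bisimilarity_of_den_eq {A : Endofunctor.Algebra SigF} (hA : rhoP.IsAdequate A) {τ : Ty}
    {p q : Mu τ} (h : (den A).f τ p = (den A).f τ q) : Bisimilarity τ p q := by
  obtain ⟨⟨N, ⟨hN⟩⟩, hA⟩ := hA
  obtain ⟨m, hm⟩ := hA N hN
  rw [← beh_eq_iff_bisimilarity hN, ← hm]
  exact congrArg (m τ) h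

end Bisimilarity

section Denotational

variable {Z : HOCoalgebra Bp} (hZ : IsTerminal Z.toCoalgebra)

/-- The element of a locally final coalgebra with a given behaviour. -/
noncomputable def ofBeh : (Bp.obj (op Z.V)).obj Z.V ⟶ Z.V :=
  Endofunctor.Coalgebra.Terminal.strInv hZ

theorem str_ofBeh (τ : Ty) (x : BObj Z.V Z.V τ) : Z.str τ (ofBeh hZ τ x) = x :=
  congrFun (congrFun (Endofunctor.Coalgebra.Terminal.left_inv hZ) τ) x

/-- One step of an application `p q`: as long as `p` reduces, so does `p q`; once `p` is a
function, `p q` reduces to its value at `q`. -/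
noncomputable def appStep {a b : Ty} (q : Z.V a) : Z.V (.arr a b) ⟶
    (distSum.obj ((obsFunctor Z.V b).obj Z.V)).obj (Z.V (.arr a b) ⨿ Z.V b) :=
  let continueAt : Z.V (.arr a b) ⟶ Z.V (.arr a b) ⨿ Z.V b := coprod.inl
  let stopAt : Z.V b ⟶ Z.V (.arr a b) ⨿ Z.V b := coprod.inr
  ↾fun p => Sum.inl <|
    Sum.elim (StdSimplex.map continueAt) (fun f => StdSimplex.single (stopAt (f q)))
      (Z.str (.arr a b) p)

/-- Application in a locally final coalgebra. -/
noncomputable def denApp {a b : Ty} (p : Z.V (.arr a b)) (q : Z.V a) : Z.V b :=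
  primCorec (isTerminalSortCoalg hZ b) (appStep q) p

theorem str_denApp {a b : Ty} (p : Z.V (.arr a b)) (q : Z.V a) :
    Z.str b (denApp hZ p q) = Sum.inl (Sum.elim (StdSimplex.map fun p' => denApp hZ p' q)
      (fun f => StdSimplex.single (f q)) (Z.str (.arr a b) p)) := by
  let corec : Z.V (.arr a b) ⟶ Z.V b := primCorec (isTerminalSortCoalg hZ b) (appStep q)
  have str_corec : Z.str b (corec p) = _ :=
    ConcreteCategory.congr_hom (primCorec_comp_str (isTerminalSortCoalg hZ b) (appStep q)) p
  refine str_corec.trans (congrArg Sum.inl ?_)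
  rcases Z.str (.arr a b) p with φ | f
  · refine (StdSimplex.map_map φ _ _).trans (congrArg φ.map (funext fun p' => ?_))
    exact ConcreteCategory.congr_hom (coprod.inl_desc corec (𝟙 (Z.V b))) p'
  · refine (StdSimplex.map_single _ _).trans (congrArg StdSimplex.single ?_)
    exact ConcreteCategory.congr_hom (coprod.inr_desc corec (𝟙 (Z.V b))) (f q)

/-- The denotation of `S''`. -/
noncomputable def denS2 {a b c : Ty} (p : Z.V (.arr a (.arr b c))) (q : Z.V (.arr a b)) :
    Z.V (.arr a c) :=
  ofBeh hZ _ (Sum.inr fun t => denApp hZ (denApp hZ p t) (denApp hZ q t))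

/-- The denotation of `S'`. -/
noncomputable def denS1 {a b c : Ty} (p : Z.V (.arr a (.arr b c))) :
    Z.V (.arr (.arr a b) (.arr a c)) :=
  ofBeh hZ _ (Sum.inr fun q => denS2 hZ p q)

/-- The denotation of `K'`. -/
noncomputable def denK1 {a : Ty} (b : Ty) (p : Z.V a) : Z.V (.arr b a) :=
  ofBeh hZ _ (Sum.inr fun _ => p)

/-- The denotations of the operations of xPTCL in a locally final coalgebra. The behaviour of
every operation except application is prescribed outright by its operational rule. -/
noncomputable def denAlg : SigF.obj Z.V ⟶ Z.V
  | _, .e => ofBeh hZ .unit (Sum.inr ())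
  | _, .app p q => denApp hZ p q
  | _, .s a b c => ofBeh hZ (.arr (.arr a (.arr b c)) _) (Sum.inr fun p => denS1 hZ p)
  | _, .s1 p => denS1 hZ p
  | _, .s2 p q => denS2 hZ p q
  | _, .k a b => ofBeh hZ (.arr a (.arr b a)) (Sum.inr fun p => denK1 hZ b p)
  | _, .k1 b p => denK1 hZ b p
  | _, .i a => ofBeh hZ (.arr a a) (Sum.inr fun p => p)
  | _, .choice p q => ofBeh hZ _ (Sum.inl (StdSimplex.duple p q
      (by norm_num : (0 : ℝ) ≤ 1 / 2) (by norm_num : (0 : ℝ) ≤ 1 / 2) (by norm_num)))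

theorem isBialgebra_denAlg : rhoP.IsBialgebra Z (denAlg hZ) := by
  refine TySet.hom_ext fun τ x => ?_
  cases x with
  | app p q =>
    refine (str_denApp hZ p q).trans ?_
    change _ = BMap (𝟙 Z.V) (Free.map (codiag Z.V) ≫ Free.hat (denAlg hZ)) τ
      (rho Z.V Z.V τ (.app (p, Z.str _ p) (q, Z.str _ q)))
    generalize Z.str _ p = y
    rcases y with φ | f <;> refine congrArg Sum.inl (Eq.symm ?_)
    · exact StdSimplex.map_map φ _ _
    · exact StdSimplex.map_single _ _
  | choice p q =>
    refine (str_ofBeh hZ _ _).trans (congrArg Sum.inl (Eq.symm ?_))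
    exact StdSimplex.map_duple _ _ _ _ _ _
  | _ => exact str_ofBeh hZ _ _

end Denotational

end XPTCL

theorem mainTheorem7 :
    (∃ Z : HOCoalgebra Bp, Z.IsLocallyFinal) ∧
    (∀ Z Z' : HOCoalgebra Bp, Z.IsLocallyFinal → Z'.IsLocallyFinal → Nonempty (Z ≅ Z')) ∧
    IsGreatest {R : ∀ τ, Setoid (Mu τ) | IsBisimulation R} Bisimilarity ∧
    (∀ (N : Endofunctor.Coalgebra (Bp.obj (op Mu))) (hN : IsTerminal N) (τ : Ty) (p q : Mu τ),
      (hN.from rhoP.opModel.toCoalgebra).f τ p = (hN.from rhoP.opModel.toCoalgebra).f τ q ↔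
        Bisimilarity τ p q) ∧
    ∀ Z : HOCoalgebra Bp, Z.IsLocallyFinal →
      ∃ a : SigF.obj Z.V ⟶ Z.V,
        rhoP.IsDenotationalModel Z a ∧
        rhoP.IsAdequate ⟨Z.V, a⟩ ∧
        ∀ (τ : Ty) (p q : Mu τ),
          (den ⟨Z.V, a⟩).f τ p = (den ⟨Z.V, a⟩).f τ q → Bisimilarity τ p q := by
  refine ⟨⟨locCoalg, isLocallyFinal_locCoalg⟩,
    fun _ _ ⟨hZ⟩ ⟨hZ'⟩ => nonempty_iso_of_isTerminal hZ hZ', isGreatest_bisimilarity,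
    fun _ hN => beh_eq_iff_bisimilarity hN, fun Z ⟨hZ⟩ => ?_⟩
  have bialgebra : rhoP.IsBialgebra Z (denAlg hZ) := isBialgebra_denAlg hZ
  have adequate : rhoP.IsAdequate ⟨Z.V, denAlg hZ⟩ :=
    bialgebra.isAdequate (isTerminalNuCoalg Mu)
  exact ⟨denAlg hZ, ⟨⟨hZ⟩, bialgebra⟩, adequate, fun _ _ _ => bisimilarity_of_den_eq adequate⟩
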